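/- For $n\ge 1$ let $C(n)$ be the set of all $2^{n-1}$ compositions of $n$, i.e. of all finite sequences $(\gamma_1,\dots,\gamma_k)$ of positive integers with $\gamma_1+\dots+\gamma_k=n$, equipped with the uniform probability measure, and let $D_n$ be the number of distinct values among the parts $\gamma_1,\dots,\gamma_k$ of a random composition. Let $\gamma$ be Euler's constant, and for real $x$ put $$g(x)=-x-\frac{\gamma}{\ln 2}+\frac12-\sum_{m=-\infty}^{0}\exp\left(-2^{-m+x}\right)+\sum_{m=1}^{\infty}\left(1-\exp\left(-2^{-m+x}\right)\right).$$ **Theorem.** The function $g:\mathbb R\to\mathbb R$ is continuous, nonconstant and periodic with period $1$, has mean zero, $\int_0^1 g(x)\,dx=0$, and satisfies $|g(x)|\le 0.0000016$ for every real $x$. As $n\to\infty$, $$\mathbb E D_n=\log_2 n+\frac{\gamma}{\ln 2}-\frac32+g(\log_2 n)+o(1).$$ -/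

import Mathlib

open Filter Topology

namespace RandomComposition

/-- The number of distinct part sizes of a composition of `n`. -/
def distinctParts {n : ℕ} (c : Composition n) : ℕ := c.blocks.toFinset.card

/-- The expected number of distinct part sizes of a composition of `n` chosen uniformly at random
(each composition has probability `1 / Fintype.card (Composition n)`, that is `2 ^ (-(n - 1))`
for `1 ≤ n`). -/
noncomputable def expectedDistinctParts (n : ℕ) : ℝ :=
  ∑ c : Composition n, (1 / (Fintype.card (Composition n) : ℝ)) * (distinctParts c : ℝ)

/-- The oscillating function
`g x = -x - γ / ln 2 + 1 / 2 - ∑_{m ≤ 0} exp (-2 ^ (-m + x)) + ∑_{m ≥ 1} (1 - exp (-2 ^ (-m + x)))`,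
with `m = -j` in the first series and `m = j + 1` in the second one, `j : ℕ`. -/
noncomputable def g (x : ℝ) : ℝ :=
  -x - Real.eulerMascheroniConstant / Real.log 2 + 1 / 2
    - ∑' j : ℕ, Real.exp (-(2 : ℝ) ^ ((j : ℝ) + x))
    + ∑' j : ℕ, (1 - Real.exp (-(2 : ℝ) ^ (-((j : ℝ) + 1) + x)))

/-- The first series in the definition of `g` converges. -/
theorem summable_left (x : ℝ) :
    Summable fun j : ℕ => Real.exp (-(2 : ℝ) ^ ((j : ℝ) + x)) := by
  have hc : (0 : ℝ) < (2 : ℝ) ^ x := Real.rpow_pos_of_pos two_pos x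
  have hs : Summable fun j : ℕ => Real.exp ((j : ℝ) * (-(2 : ℝ) ^ x)) :=
    Real.summable_exp_nat_mul_iff.mpr (by linarith)
  refine Summable.of_nonneg_of_le (fun j => (Real.exp_pos _).le) (fun j => ?_) hs
  apply Real.exp_le_exp.mpr
  rw [Real.rpow_add two_pos, Real.rpow_natCast]
  have hj : (j : ℝ) ≤ 2 ^ j := by exact_mod_cast Nat.lt_two_pow_self.le
  nlinarith

/-- The second series in the definition of `g` converges. -/
theorem summable_right (x : ℝ) :
    Summable fun j : ℕ => 1 - Real.exp (-(2 : ℝ) ^ (-((j : ℝ) + 1) + x)) := by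
  have hs : Summable fun j : ℕ => (2 : ℝ) ^ (-1 + x) * (1 / 2 : ℝ) ^ j :=
    summable_geometric_two.mul_left _
  refine Summable.of_nonneg_of_le (fun j => ?_) (fun j => ?_) hs
  · have h : (0 : ℝ) < (2 : ℝ) ^ (-((j : ℝ) + 1) + x) := Real.rpow_pos_of_pos two_pos _
    have : Real.exp (-(2 : ℝ) ^ (-((j : ℝ) + 1) + x)) ≤ 1 := Real.exp_le_one_iff.mpr (by linarith)
    linarith
  · have h : (2 : ℝ) ^ (-((j : ℝ) + 1) + x) = (2 : ℝ) ^ (-1 + x) * (1 / 2 : ℝ) ^ j := by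
      rw [show -((j : ℝ) + 1) + x = (-1 + x) + -(j : ℝ) by ring, Real.rpow_add two_pos,
        Real.rpow_neg two_pos.le, Real.rpow_natCast, one_div, inv_pow]
    rw [← h]
    have := Real.add_one_le_exp (-(2 : ℝ) ^ (-((j : ℝ) + 1) + x))
    linarith

end RandomComposition

/-!
Let `p_k(n)` be the probability that no part of a random composition of `n` equals `k`, so that the
expected number of distinct parts is `∑_k (1 - p_k(n))`. Splitting off the first block gives a
linear recurrence for `p_k`, which says that `p_k(n + 1) = (1 - ε) p_k(n) + O(k ε ^ 2)` with
`ε = 2 ^ (-k) / 2`. The sequence `exp (-n ε)` satisfies the same relation, whence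
`|p_k(n) - exp (-n ε)| = O(k 2 ^ (-k))` uniformly in `n` (`abs_avoidProb_sub_exp_le`). For fixed `k`
both terms tend to `0` as `n → ∞`, so by dominated convergence for series the expectation is
`∑_{k ≥ 1} (1 - exp (-n 2 ^ (-k) / 2)) + o(1)`. This sum is the second series of `g` at
`log₂ n - 1`; the first series tends to `0` there, and `g` has period `1`
(`tendsto_expectedDistinctParts`).

The derivative of `g` is `-1 + ∑_{m ∈ ℤ} φ (x + m)` with `φ y = log 2 · 2 ^ y · exp (-2 ^ y)`
(`hasDerivAt_g`). The Fourier coefficients of a periodization are values of the Fourier transform of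
the function, and the substitution `t = 2 ^ y` turns the Fourier transform of `φ` into Euler's
integral. Thus for `n ≠ 0` the `n`-th Fourier coefficient of `g` is
`Γ(1 - 2 π i n / log 2) / (2 π i n)` (`fourierCoeffOn_g`). It does not vanish, so `g` is not
constant. By the reflection formula its squared norm is
`1 / (2 log 2 · n · sinh (2 π ^ 2 n / log 2))`; the terms `n = ± 1` contribute
`1.573 * 10⁻⁶`, and the others are negligible (`abs_g_le`).

The constant Fourier coefficient vanishes because the two series of `g` form the periodization of an
integrable function with a jump at `0`, whose integral is by parts
`-∫ y φ y dy = -Γ'(1) / log 2 = γ / log 2` (`integral_stepKernel`).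
-/

namespace RandomComposition

open MeasureTheory

/-! ### Compositions avoiding a given part -/

/-- The number of compositions of `n` none of whose parts equals `k`. -/
def avoidCount (k n : ℕ) : ℕ :=
  (Finset.univ.filter fun c : Composition n => k ∉ c.blocks).card

/-- The block lists of the compositions of `n` without the part `k`. Working with plain lists
avoids the dependence of `Composition n` on `n` when the first block is removed. -/
def avoidLists (k n : ℕ) : Finset (List ℕ) :=
  (Finset.univ.filter fun c : Composition n => k ∉ c.blocks).image Composition.blocks

theorem card_avoidLists (k n : ℕ) : (avoidLists k n).card = avoidCount k n :=
  Finset.card_image_of_injective _ fun _ _ h => Composition.ext h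

theorem mem_avoidLists {k n : ℕ} {l : List ℕ} :
    l ∈ avoidLists k n ↔ (∀ i ∈ l, 0 < i) ∧ l.sum = n ∧ k ∉ l := by
  simp only [avoidLists, Finset.mem_image, Finset.mem_filter, Finset.mem_univ, true_and]
  constructor
  · rintro ⟨c, hc, rfl⟩
    exact ⟨fun i hi => c.blocks_pos hi, c.blocks_sum, hc⟩
  · rintro ⟨hpos, hsum, hk⟩
    exact ⟨⟨l, fun {i} hi => hpos i hi, hsum⟩, hk, rfl⟩

theorem avoidLists_succ (k n : ℕ) :
    avoidLists k (n + 1) = ((Finset.range (n + 1)).filter fun j => j + 1 ≠ k).biUnion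
      fun j => (avoidLists k (n - j)).image (List.cons (j + 1)) := by
  ext l
  simp only [Finset.mem_biUnion, Finset.mem_filter, Finset.mem_range, Finset.mem_image,
    mem_avoidLists]
  constructor
  · rintro ⟨hpos, hsum, hk⟩
    cases l with
    | nil => simp at hsum
    | cons b t =>
      simp only [List.mem_cons, forall_eq_or_imp, List.sum_cons, not_or] at hpos hsum hk
      refine ⟨b - 1, ⟨by omega, by omega⟩, t, ⟨hpos.2, by omega, hk.2⟩, ?_⟩
      rw [Nat.sub_add_cancel hpos.1]
  · rintro ⟨j, ⟨hj, hjk⟩, t, ⟨hpos, hsum, hk⟩, rfl⟩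
    refine ⟨?_, ?_, ?_⟩
    · simpa using hpos
    · simp only [List.sum_cons]; omega
    · simp only [List.mem_cons, not_or]; exact ⟨fun h => hjk h.symm, hk⟩

/-- Splitting off the first block, which may have any size except `k`. -/
theorem avoidCount_succ (k n : ℕ) :
    avoidCount k (n + 1) =
      ∑ j ∈ Finset.range (n + 1), if j + 1 = k then 0 else avoidCount k (n - j) := by
  rw [← card_avoidLists, avoidLists_succ, Finset.card_biUnion]
  · rw [Finset.sum_filter]
    refine Finset.sum_congr rfl fun j _ => ?_
    rw [Finset.card_image_of_injective _ List.cons_injective, card_avoidLists]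
    by_cases h : j + 1 = k <;> simp [h]
  · intro i _ j _ hij
    rw [Function.onFun, Finset.disjoint_left]
    intro l hi hj
    simp only [Finset.mem_image] at hi hj
    obtain ⟨t, _, rfl⟩ := hi
    obtain ⟨s, _, hs⟩ := hj
    simp only [List.cons.injEq] at hs
    omega

theorem avoidCount_of_lt {k n : ℕ} (h : n < k) : avoidCount k n = 2 ^ (n - 1) := by
  rw [avoidCount, Finset.filter_true_of_mem, Finset.card_univ, composition_card]
  intro c _ hc
  exact absurd (c.blocks_le hc) (by omega)

theorem avoidCount_zero {k : ℕ} (hk : 1 ≤ k) : avoidCount k 0 = 1 := by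
  rw [avoidCount_of_lt (by omega)]
  simp

theorem avoidCount_le (k n : ℕ) : avoidCount k n ≤ 2 ^ (n - 1) := by
  rw [← composition_card, ← Finset.card_univ]
  exact Finset.card_filter_le _ _

theorem avoidCount_succ_add {k n : ℕ} (hk : 1 ≤ k) (h : k ≤ n + 1) :
    avoidCount k (n + 1) + avoidCount k (n + 1 - k) =
      ∑ i ∈ Finset.range (n + 1), avoidCount k i := by
  rw [avoidCount_succ, ← Finset.sum_range_reflect (fun i => avoidCount k i)]
  have hmem : k - 1 ∈ Finset.range (n + 1) := by simp; omega
  rw [← Finset.add_sum_erase _ _ hmem, ← Finset.add_sum_erase _ _ hmem,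
    if_pos (Nat.sub_add_cancel hk), zero_add, add_comm]
  congr 1
  · congr 1; omega
  · refine Finset.sum_congr rfl fun j hj => ?_
    rw [Finset.mem_erase] at hj
    rw [if_neg (by omega)]
    congr 1

theorem avoidCount_rec {k n : ℕ} (hk : 1 ≤ k) (h : k ≤ n) :
    avoidCount k (n + 1) + avoidCount k (n + 1 - k) =
      2 * avoidCount k n + avoidCount k (n - k) := by
  obtain ⟨m, rfl⟩ : ∃ m, n = m + 1 := ⟨n - 1, by omega⟩
  rw [avoidCount_succ_add hk (by omega), Finset.sum_range_succ, ← avoidCount_succ_add hk h]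
  ring

theorem avoidCount_self {k : ℕ} (hk : 1 ≤ k) : avoidCount k k + 1 = 2 ^ (k - 1) := by
  obtain ⟨m, rfl⟩ : ∃ m, k = m + 1 := ⟨k - 1, by omega⟩
  have h := avoidCount_succ_add (k := m + 1) (n := m) hk le_rfl
  rw [Nat.sub_self, avoidCount_zero hk] at h
  rw [h, Finset.sum_range_succ', avoidCount_zero hk, Nat.add_sub_cancel,
    Finset.sum_congr rfl (g := fun i => 2 ^ i) fun i hi => by
      rw [Finset.mem_range] at hi
      rw [avoidCount_of_lt (by omega), Nat.add_sub_cancel]]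
  have := Nat.geomSum_eq (le_refl 2) m
  have := Nat.one_le_two_pow (n := m)
  omega

/-! ### The probability of avoiding a part -/

/-- The probability that a random composition of `n ≥ 1` has no part `k`. The normalization
`2 / 2 ^ n` instead of `1 / 2 ^ (n - 1)` gives the value `2` at `n = 0`, for which the linear
recurrence `avoidProb_succ` already holds at `n = k`. -/
noncomputable def avoidProb (k n : ℕ) : ℝ := 2 * (avoidCount k n : ℝ) / 2 ^ n

theorem avoidProb_nonneg (k n : ℕ) : 0 ≤ avoidProb k n := by
  unfold avoidProb; positivity

theorem avoidProb_zero {k : ℕ} (hk : 1 ≤ k) : avoidProb k 0 = 2 := by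
  simp [avoidProb, avoidCount_zero hk]

theorem avoidProb_eq_div {k n : ℕ} (hn : 1 ≤ n) :
    avoidProb k n = (avoidCount k n : ℝ) / 2 ^ (n - 1) := by
  obtain ⟨m, rfl⟩ : ∃ m, n = m + 1 := ⟨n - 1, by omega⟩
  rw [avoidProb, Nat.add_sub_cancel, pow_succ]
  field_simp

theorem avoidProb_le_one {k n : ℕ} (hn : 1 ≤ n) : avoidProb k n ≤ 1 := by
  rw [avoidProb_eq_div hn, div_le_one (by positivity)]
  exact_mod_cast avoidCount_le k n

theorem avoidProb_of_lt {k n : ℕ} (hn : 1 ≤ n) (h : n < k) : avoidProb k n = 1 := by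
  rw [avoidProb_eq_div hn, avoidCount_of_lt h]
  simp

theorem avoidProb_self {k : ℕ} (hk : 1 ≤ k) : avoidProb k k = 1 - 2 * (1 / 2) ^ k := by
  have h : (avoidCount k k : ℝ) = 2 ^ (k - 1) - 1 := by
    rw [eq_sub_iff_add_eq]; exact_mod_cast avoidCount_self hk
  have h2 : (2 : ℝ) ^ k = 2 * 2 ^ (k - 1) := by rw [← pow_succ', Nat.sub_add_cancel hk]
  rw [avoidProb, h, one_div, inv_pow, h2]
  field_simp

theorem avoidProb_succ {k n : ℕ} (hk : 1 ≤ k) (h : k ≤ n) :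
    avoidProb k (n + 1) = avoidProb k n - (1 / 2) ^ k * avoidProb k (n + 1 - k)
      + (1 / 2) ^ k / 2 * avoidProb k (n - k) := by
  obtain ⟨m, rfl⟩ : ∃ m, n = k + m := ⟨n - k, by omega⟩
  have e : (avoidCount k (k + m + 1) : ℝ) =
      2 * avoidCount k (k + m) + avoidCount k m - avoidCount k (m + 1) := by
    have := avoidCount_rec hk h
    rw [show k + m + 1 - k = m + 1 by omega, show k + m - k = m by omega] at this
    rw [eq_sub_iff_add_eq]; exact_mod_cast this
  rw [show k + m + 1 - k = m + 1 by omega, show k + m - k = m by omega]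
  simp only [avoidProb, e, one_div, inv_pow]
  field_simp
  ring

theorem half_pow_le_half {k : ℕ} (hk : 1 ≤ k) : (1 / 2 : ℝ) ^ k ≤ 1 / 2 :=
  (pow_le_pow_of_le_one (by norm_num) (by norm_num) hk).trans_eq (pow_one _)

theorem abs_avoidProb_succ_sub_le {k n : ℕ} (hk : 1 ≤ k) (hn : 1 ≤ n) :
    |avoidProb k (n + 1) - avoidProb k n| ≤ 2 * (1 / 2) ^ k := by
  have hd : (0 : ℝ) < (1 / 2) ^ k := by positivity
  rcases lt_trichotomy (n + 1) k with h | h | h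
  · rw [avoidProb_of_lt (by omega) h, avoidProb_of_lt hn (by omega)]
    simp
  · subst h
    rw [avoidProb_self hk, avoidProb_of_lt hn (by omega), abs_le]
    constructor <;> linarith
  · have hle : k ≤ n := by omega
    rw [avoidProb_succ hk hle]
    have h1 := avoidProb_nonneg k (n + 1 - k)
    have h2 := avoidProb_le_one (k := k) (n := n + 1 - k) (by omega)
    have h3 := avoidProb_nonneg k (n - k)
    have h4 : avoidProb k (n - k) ≤ 2 := by
      rcases Nat.eq_zero_or_pos (n - k) with h0 | h0
      · rw [h0, avoidProb_zero hk]
      · exact (avoidProb_le_one h0).trans (by norm_num)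
    rw [abs_le]
    constructor <;> nlinarith

theorem abs_avoidProb_add_sub_le {k n : ℕ} (hk : 1 ≤ k) (hn : 1 ≤ n) (m : ℕ) :
    |avoidProb k (n + m) - avoidProb k n| ≤ m * (2 * (1 / 2) ^ k) := by
  induction m with
  | zero => simp
  | succ m ih =>
    have := abs_avoidProb_succ_sub_le hk (n := n + m) (by omega)
    have h3 := abs_sub_le (avoidProb k (n + m + 1)) (avoidProb k (n + m)) (avoidProb k n)
    rw [← add_assoc]
    push_cast
    linarith

/-- For a fixed part `k`, the quantity
`avoidProb k (n + k) + ε (avoidProb k 0 + ⋯ + avoidProb k n) + ε avoidProb k n` with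
`ε = 2 ^ (-k) / 2` does not depend on `n`, by the linear recurrence. -/
theorem avoidProb_invariant {k : ℕ} (hk : 1 ≤ k) (n : ℕ) :
    avoidProb k (n + k) + (1 / 2) ^ k / 2 * ∑ i ∈ Finset.range (n + 1), avoidProb k i
      + (1 / 2) ^ k / 2 * avoidProb k n = 1 := by
  induction n with
  | zero =>
    simp only [zero_add, Finset.range_one, Finset.sum_singleton, avoidProb_zero hk,
      avoidProb_self hk]
    ring
  | succ n ih =>
    rw [Finset.sum_range_succ, show n + 1 + k = n + k + 1 by ring,
      avoidProb_succ hk (by omega : k ≤ n + k), show n + k + 1 - k = n + 1 by omega,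
      show n + k - k = n by omega]
    linarith

theorem tendsto_avoidProb {k : ℕ} (hk : 1 ≤ k) : Tendsto (avoidProb k) atTop (𝓝 0) := by
  have hd : (0 : ℝ) < (1 / 2) ^ k / 2 := by positivity
  have hs : Summable (avoidProb k) := by
    refine summable_of_sum_range_le (c := 1 / ((1 / 2) ^ k / 2)) (avoidProb_nonneg k) fun n => ?_
    rw [le_div_iff₀ hd]
    have h := avoidProb_invariant hk n
    rw [Finset.sum_range_succ] at h
    have h1 := avoidProb_nonneg k n
    have h2 := avoidProb_nonneg k (n + k)
    nlinarith
  exact hs.tendsto_atTop_zero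

/-- Uniform exponential approximation. The recurrence reads
`avoidProb k (n + 1) = (1 - ε) avoidProb k n + O(k ε ^ 2)` with `ε = 2 ^ (-k) / 2`, and
`exp (- n ε)` satisfies the same relation, so the errors sum up to at most `O(k ε)`. -/
theorem abs_avoidProb_sub_exp_le {k n : ℕ} (hk : 1 ≤ k) (hn : 1 ≤ n) :
    |avoidProb k n - Real.exp (-(n * ((1 / 2) ^ k / 2)))| ≤ (6 * k + 7) * (1 / 2 : ℝ) ^ k := by
  set d : ℝ := (1 / 2) ^ k with hdef
  have hd : 0 < d := by positivity
  have hd2 : d ≤ 1 / 2 := half_pow_le_half hk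
  have hk' : (1 : ℝ) ≤ k := by exact_mod_cast hk
  have hexp : ∀ m : ℕ, 1 - m * (d / 2) ≤ Real.exp (-(m * (d / 2))) ∧
      Real.exp (-(m * (d / 2))) ≤ 1 := fun m => by
    have h0 : (0 : ℝ) ≤ m * (d / 2) := by positivity
    exact ⟨by linarith [Real.add_one_le_exp (-(m * (d / 2)))],
      Real.exp_le_one_iff.mpr (by linarith)⟩
  -- The start of the recurrence: both quantities are within `O(k ε)` of `1`.
  have hstart : ∀ m : ℕ, 1 ≤ m → m ≤ k + 1 →
      |avoidProb k m - Real.exp (-(m * (d / 2)))| ≤ (6 * k + 7) * d := by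
    intro m hm hmk
    obtain ⟨h1, h2⟩ := hexp m
    have hm' : (m : ℝ) ≤ k + 1 := by exact_mod_cast hmk
    have hp1 := avoidProb_le_one (k := k) hm
    have hp2 : 1 - 2 * d ≤ avoidProb k m := by
      rcases lt_trichotomy m k with h | h | h
      · rw [avoidProb_of_lt hm h]; linarith
      · rw [h, avoidProb_self hk]
      · obtain rfl : m = k + 1 := by omega
        rw [avoidProb_succ hk le_rfl, avoidProb_self hk, Nat.sub_self, avoidProb_zero hk,
          show k + 1 - k = 1 by omega]
        have := avoidProb_le_one (k := k) le_rfl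
        rw [← hdef]
        nlinarith
    rw [abs_le]
    constructor <;> nlinarith
  rcases le_or_gt n (k + 1) with hnk | hnk
  · exact hstart n hn hnk
  · clear hn
    induction n, hnk.le using Nat.le_induction with
    | base => exact hstart _ (by omega) le_rfl
    | succ n hkn ih =>
      replace ih : |avoidProb k n - Real.exp (-(n * (d / 2)))| ≤ (6 * k + 7) * d := by
        rcases hkn.eq_or_lt with h | h
        · rw [← h]; exact hstart _ (by omega) le_rfl
        · exact ih h
      have hdiff : ∀ j : ℕ, 1 ≤ j → j ≤ n → n ≤ j + k →
          |avoidProb k n - avoidProb k j| ≤ k * (2 * d) := by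
        intro j hj hjn hnj
        obtain ⟨m, rfl⟩ : ∃ m, n = j + m := ⟨n - j, by omega⟩
        have hmk : (m : ℝ) ≤ k := by exact_mod_cast (by omega : m ≤ k)
        exact (abs_avoidProb_add_sub_le hk hj m).trans (by gcongr)
      have h1 := abs_le.mp (hdiff (n + 1 - k) (by omega) (by omega) (by omega))
      have h2 := abs_le.mp (hdiff (n - k) (by omega) (by omega) (by omega))
      have hE := (hexp n).2
      have hE0 := Real.exp_pos (-(n * (d / 2)))
      have hq := abs_le.mp (Real.abs_exp_sub_one_sub_id_le (x := -(d / 2))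
        (by rw [abs_neg, abs_of_pos (by linarith)]; linarith))
      have hstep : Real.exp (-((n + 1 : ℕ) * (d / 2))) =
          Real.exp (-(n * (d / 2))) * Real.exp (-(d / 2)) := by
        rw [← Real.exp_add]; push_cast; ring_nf
      rw [hstep, avoidProb_succ hk (by omega : k ≤ n), ← hdef]
      set E := Real.exp (-(n * (d / 2)))
      set q := Real.exp (-(d / 2))
      set P := avoidProb k n
      set P1 := avoidProb k (n + 1 - k)
      set P2 := avoidProb k (n - k)
      -- The error splits into the contracted old one and three terms of order `k ε ^ 2`.
      have hdecomp : P - d * P1 + d / 2 * P2 - E * q =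
          (1 - d / 2) * (P - E) + d * (P - P1) - d / 2 * (P - P2)
            - E * (q - 1 - -(d / 2)) := by ring
      have e0 : |(1 - d / 2) * (P - E)| ≤ (1 - d / 2) * ((6 * k + 7) * d) := by
        rw [abs_mul, abs_of_nonneg (by linarith : 0 ≤ 1 - d / 2)]
        exact mul_le_mul_of_nonneg_left ih (by linarith)
      have e1 : |d * (P - P1)| ≤ d * (k * (2 * d)) := by
        rw [abs_mul, abs_of_pos hd]
        exact mul_le_mul_of_nonneg_left (abs_le.mpr h1) hd.le
      have e2 : |d / 2 * (P - P2)| ≤ d / 2 * (k * (2 * d)) := by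
        rw [abs_mul, abs_of_pos (by linarith : 0 < d / 2)]
        exact mul_le_mul_of_nonneg_left (abs_le.mpr h2) (by linarith)
      have e3 : |E * (q - 1 - -(d / 2))| ≤ 1 * (-(d / 2)) ^ 2 := by
        rw [abs_mul, abs_of_pos hE0]
        exact mul_le_mul hE (abs_le.mpr hq) (abs_nonneg _) zero_le_one
      have hkd : 0 ≤ k * d ^ 2 := by positivity
      rw [hdecomp]
      refine (abs_sub _ _).trans ((add_le_add ((abs_sub _ _).trans
        (add_le_add ((abs_add_le _ _).trans (add_le_add e0 e1)) e2)) e3).trans ?_)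
      nlinarith [sq_nonneg d]

/-! ### The expected number of distinct parts -/

theorem distinctParts_eq_sum {n : ℕ} (c : Composition n) :
    distinctParts c = ∑ k ∈ Finset.range n, if k + 1 ∉ c.blocks then 0 else 1 := by
  have h : c.blocks.toFinset = ((Finset.range n).filter fun k => k + 1 ∈ c.blocks).map
      ⟨fun k => k + 1, add_left_injective 1⟩ := by
    ext i
    simp only [List.mem_toFinset, Finset.mem_map, Finset.mem_filter, Finset.mem_range,
      Function.Embedding.coeFn_mk]
    constructor
    · intro hi
      have h1 := c.one_le_blocks hi
      have h2 := c.blocks_le hi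
      exact ⟨i - 1, ⟨by omega, by rwa [Nat.sub_add_cancel h1]⟩, Nat.sub_add_cancel h1⟩
    · rintro ⟨k, ⟨_, hk⟩, rfl⟩
      exact hk
  rw [distinctParts, h, Finset.card_map, Finset.card_filter]
  exact Finset.sum_congr rfl fun k _ => by by_cases hk : k + 1 ∈ c.blocks <;> simp [hk]

theorem expectedDistinctParts_eq_tsum {n : ℕ} (hn : 1 ≤ n) :
    expectedDistinctParts n = ∑' k : ℕ, (1 - avoidProb (k + 1) n) := by
  rw [tsum_eq_sum (s := Finset.range n) fun k hk => by
    rw [avoidProb_of_lt hn (by simpa [Nat.lt_succ_iff] using hk), sub_self]]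
  have hcard : (Fintype.card (Composition n) : ℝ) = 2 ^ (n - 1) := by
    rw [composition_card]; push_cast; rfl
  simp only [expectedDistinctParts, hcard, distinctParts_eq_sum]
  push_cast
  rw [← Finset.mul_sum, Finset.sum_comm, Finset.mul_sum]
  refine Finset.sum_congr rfl fun k _ => ?_
  have hcount : (∑ c : Composition n, if k + 1 ∉ c.blocks then (0 : ℝ) else 1) =
      2 ^ (n - 1) - avoidCount (k + 1) n := by
    have h1 : ∀ c : Composition n, (if k + 1 ∉ c.blocks then (0 : ℝ) else 1) =
        1 - if k + 1 ∉ c.blocks then 1 else 0 := fun c => by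
      by_cases h : k + 1 ∈ c.blocks <;> simp [h]
    rw [Finset.sum_congr rfl fun c _ => h1 c, Finset.sum_sub_distrib, Finset.sum_boole]
    simp only [Finset.sum_const, Finset.card_univ, nsmul_eq_mul, mul_one, hcard]
    rfl
  rw [hcount, avoidProb_eq_div hn]
  field_simp

theorem summable_linear_mul_half_pow :
    Summable fun k : ℕ => (6 * ((k + 1 : ℕ) : ℝ) + 7) * (1 / 2 : ℝ) ^ (k + 1) := by
  have h1 : Summable fun k : ℕ => (k : ℝ) ^ 1 * (1 / 2 : ℝ) ^ k :=
    summable_pow_mul_geometric_of_norm_lt_one 1 (by norm_num)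
  have h2 : Summable fun k : ℕ => (1 / 2 : ℝ) ^ k := summable_geometric_two
  refine ((summable_nat_add_iff 1).mpr ((h1.mul_left 6).add (h2.mul_left 7))).congr fun k => ?_
  push_cast
  ring

/-- At `x = log₂ n - 1` the second series of `g` has the terms `1 - exp (-n ε)` with
`ε = 2 ^ (-k) / 2` and `k = j + 1`. -/
theorem rightSeries_logb {n : ℕ} (hn : 1 ≤ n) (j : ℕ) :
    (2 : ℝ) ^ (-((j : ℝ) + 1) + (Real.logb 2 n - 1)) = n * ((1 / 2) ^ (j + 1) / 2) := by
  have hn' : (0 : ℝ) < n := by exact_mod_cast hn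
  rw [show -((j : ℝ) + 1) + (Real.logb 2 n - 1) = Real.logb 2 n + (-(((j + 1 : ℕ) : ℝ)) + -1) by
      push_cast; ring,
    Real.rpow_add two_pos, Real.rpow_add two_pos, Real.rpow_logb two_pos (by norm_num) hn',
    Real.rpow_neg two_pos.le, Real.rpow_natCast, Real.rpow_neg_one, one_div, inv_pow]
  rfl

/-- The errors `avoidProb k n - exp (- n 2 ^ (-k) / 2)` tend to `0` for each `k` and are
dominated by a summable sequence in `k`, so their sum tends to `0`. -/
theorem tendsto_expectedDistinctParts_sub_rightSeries :
    Tendsto (fun n : ℕ => expectedDistinctParts n -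
      ∑' j : ℕ, (1 - Real.exp (-(2 : ℝ) ^ (-((j : ℝ) + 1) + (Real.logb 2 n - 1)))))
      atTop (𝓝 0) := by
  have key : Tendsto (fun n : ℕ => ∑' k : ℕ,
      (Real.exp (-(n * ((1 / 2 : ℝ) ^ (k + 1) / 2))) - avoidProb (k + 1) n)) atTop
      (𝓝 (∑' _ : ℕ, (0 : ℝ))) := by
    refine tendsto_tsum_of_dominated_convergence summable_linear_mul_half_pow (fun k => ?_) ?_
    · rw [← sub_zero (0 : ℝ)]
      refine Tendsto.sub (Real.tendsto_exp_neg_atTop_nhds_zero.comp ?_)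
        (tendsto_avoidProb (by omega))
      exact tendsto_natCast_atTop_atTop.atTop_mul_const (by positivity)
    · filter_upwards [eventually_ge_atTop 1] with n hn k
      rw [Real.norm_eq_abs, abs_sub_comm]
      exact abs_avoidProb_sub_exp_le (by omega) hn
  rw [tsum_zero] at key
  refine key.congr' ?_
  filter_upwards [eventually_ge_atTop 1] with n hn
  have hs := summable_right (Real.logb 2 n - 1)
  rw [expectedDistinctParts_eq_tsum hn, ← Summable.tsum_sub _ hs]
  · refine tsum_congr fun k => ?_
    rw [rightSeries_logb hn]
    ring
  · refine summable_of_ne_finset_zero (s := Finset.range n) fun k hk => ?_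
    rw [avoidProb_of_lt hn (by simpa [Nat.lt_succ_iff] using hk), sub_self]

theorem tendsto_leftSeries :
    Tendsto (fun x : ℝ => ∑' j : ℕ, Real.exp (-(2 : ℝ) ^ ((j : ℝ) + x))) atTop (𝓝 0) := by
  have hle : ∀ (x : ℝ) (j : ℕ),
      Real.exp (-(2 : ℝ) ^ ((j : ℝ) + x)) ≤ (2 : ℝ) ^ (-x) * (1 / 2) ^ j := by
    intro x j
    have hp : (0 : ℝ) < (2 : ℝ) ^ ((j : ℝ) + x) := Real.rpow_pos_of_pos two_pos _
    have e : (2 : ℝ) ^ (-x) * (1 / 2) ^ j = ((2 : ℝ) ^ ((j : ℝ) + x))⁻¹ := by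
      rw [Real.rpow_neg two_pos.le, Real.rpow_add two_pos, Real.rpow_natCast, one_div, inv_pow,
        mul_inv, mul_comm]
    rw [e, Real.exp_neg]
    exact inv_anti₀ hp (by linarith [Real.add_one_le_exp ((2 : ℝ) ^ ((j : ℝ) + x))])
  have hlim : Tendsto (fun x : ℝ => (2 : ℝ) ^ (-x) * 2) atTop (𝓝 0) := by
    have h := (tendsto_rpow_atTop_of_base_gt_one 2 one_lt_two).inv_tendsto_atTop
    simpa [Real.rpow_neg two_pos.le] using h.mul_const 2
  refine squeeze_zero (fun x => tsum_nonneg fun j => (Real.exp_pos _).le) (fun x => ?_) hlim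
  refine ((summable_left x).tsum_le_tsum (hle x) (summable_geometric_two.mul_left _)).trans_eq ?_
  rw [tsum_mul_left, tsum_geometric_two]

/-! ### Periodicity of `g` and the asymptotic expansion -/

theorem periodic_g : Function.Periodic g 1 := by
  intro x
  have hl : ∑' j : ℕ, Real.exp (-(2 : ℝ) ^ ((j : ℝ) + x)) = Real.exp (-(2 : ℝ) ^ x) +
      ∑' j : ℕ, Real.exp (-(2 : ℝ) ^ ((j : ℝ) + (x + 1))) := by
    rw [(summable_left x).tsum_eq_zero_add]
    simp only [Nat.cast_zero, zero_add, Nat.cast_add, Nat.cast_one, add_assoc, add_comm (1 : ℝ) x]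
  have hr : ∑' j : ℕ, (1 - Real.exp (-(2 : ℝ) ^ (-((j : ℝ) + 1) + (x + 1)))) =
      1 - Real.exp (-(2 : ℝ) ^ x) +
        ∑' j : ℕ, (1 - Real.exp (-(2 : ℝ) ^ (-((j : ℝ) + 1) + x))) := by
    rw [(summable_right (x + 1)).tsum_eq_zero_add]
    congr 1
    · simp
    · refine tsum_congr fun j => ?_
      push_cast
      ring_nf
  rw [g, g, hl, hr]
  ring

theorem tendsto_expectedDistinctParts :
    Tendsto (fun n : ℕ => expectedDistinctParts n -
      (Real.logb 2 (n : ℝ) + Real.eulerMascheroniConstant / Real.log 2 - 3 / 2 +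
        g (Real.logb 2 (n : ℝ)))) atTop (𝓝 0) := by
  have hlog : Tendsto (fun n : ℕ => Real.logb 2 n - 1) atTop atTop :=
    tendsto_atTop_add_const_right _ _
      ((Real.tendsto_logb_atTop one_lt_two).comp tendsto_natCast_atTop_atTop)
  have h := tendsto_expectedDistinctParts_sub_rightSeries.add (tendsto_leftSeries.comp hlog)
  rw [add_zero] at h
  refine h.congr fun n => ?_
  rw [← periodic_g.sub_eq (Real.logb 2 n), g, Function.comp]
  ring

/-! ### Functions with exponential decay and their periodizations -/

theorem two_rpow_neg_abs_add_le {R x : ℝ} (hx : |x| ≤ R) (y : ℝ) :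
    (2 : ℝ) ^ (-|x + y|) ≤ 2 ^ R * 2 ^ (-|y|) := by
  rw [← Real.rpow_add two_pos]
  refine Real.rpow_le_rpow_of_exponent_le one_le_two ?_
  have := abs_sub_abs_le_abs_sub y (-x)
  rw [abs_neg, sub_neg_eq_add, add_comm y x] at this
  linarith

theorem summable_two_rpow_neg_abs_int : Summable fun m : ℤ => (2 : ℝ) ^ (-|(m : ℝ)|) := by
  refine Summable.of_nat_of_neg ?_ ?_ <;>
  · refine summable_geometric_two.congr fun n => ?_
    simp [Real.rpow_neg]

theorem integrable_two_rpow_neg_abs : Integrable fun y : ℝ => (2 : ℝ) ^ (-|y|) := by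
  have h1 : IntegrableOn (fun y : ℝ => (2 : ℝ) ^ (-|y|)) (Set.Ioi 0) := by
    refine (exp_neg_integrableOn_Ioi 0 (Real.log_pos one_lt_two)).congr_fun (fun y hy => ?_)
      measurableSet_Ioi
    simp only [abs_of_pos (Set.mem_Ioi.mp hy), Real.rpow_def_of_pos two_pos]
    ring_nf
  have h2 : IntegrableOn (fun y : ℝ => (2 : ℝ) ^ (-|y|)) (Set.Iic 0) := by
    rw [← integrableOn_Ici_iff_integrableOn_Ioi, ← neg_zero] at h1
    simpa using h1.comp_neg_Iic
  rw [← integrableOn_univ, ← Set.Iic_union_Ioi (a := (0 : ℝ))]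
  exact h2.union h1

theorem abs_mul_two_rpow_neg_abs_le (y : ℝ) :
    |y| * (2 : ℝ) ^ (-|y|) ≤ 3 * 2 ^ (-|1 / 2 * y|) := by
  have h1 : (2 : ℝ) ^ (-|y|) = 2 ^ (-|1 / 2 * y|) * 2 ^ (-(|y| / 2)) := by
    rw [← Real.rpow_add two_pos, abs_mul, abs_of_pos (by norm_num : (0 : ℝ) < 1 / 2)]
    congr 1; ring
  have h2 : |y| ≤ 3 * 2 ^ (|y| / 2) := by
    rw [Real.rpow_def_of_pos two_pos]
    have := Real.add_one_le_exp (Real.log 2 * (|y| / 2))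
    nlinarith [Real.log_two_gt_d9, abs_nonneg y]
  have h3 : (2 : ℝ) ^ (|y| / 2) * 2 ^ (-(|y| / 2)) = 1 := by
    rw [← Real.rpow_add two_pos]; simp
  have h4 : (0 : ℝ) < 2 ^ (-(|y| / 2)) := Real.rpow_pos_of_pos two_pos _
  have h5 : (0 : ℝ) < 2 ^ (-|1 / 2 * y|) := Real.rpow_pos_of_pos two_pos _
  rw [h1]
  calc |y| * (2 ^ (-|1 / 2 * y|) * 2 ^ (-(|y| / 2)))
      = 2 ^ (-|1 / 2 * y|) * (|y| * 2 ^ (-(|y| / 2))) := by ring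
    _ ≤ 2 ^ (-|1 / 2 * y|) * (3 * 2 ^ (|y| / 2) * 2 ^ (-(|y| / 2))) := by gcongr
    _ = 3 * 2 ^ (-|1 / 2 * y|) := by rw [mul_assoc 3, h3]; ring

theorem integrable_two_rpow_neg_abs_half : Integrable fun y : ℝ => (2 : ℝ) ^ (-|1 / 2 * y|) :=
  integrable_two_rpow_neg_abs.comp_mul_left' (by norm_num)

theorem integrable_of_norm_le_decay {E : Type*} [NormedAddCommGroup E] {f : ℝ → E} {C : ℝ}
    (hf : AEStronglyMeasurable f) (hC : ∀ y, ‖f y‖ ≤ C * 2 ^ (-|y|)) : Integrable f :=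
  (integrable_two_rpow_neg_abs.const_mul C).mono' hf (ae_of_all _ hC)

theorem summable_comp_add_int {E : Type*} [NormedAddCommGroup E] [CompleteSpace E] {f : ℝ → E}
    {C : ℝ} (hC : ∀ y, ‖f y‖ ≤ C * 2 ^ (-|y|)) (x : ℝ) :
    Summable fun m : ℤ => f (x + m) := by
  have hC0 : 0 ≤ C := by simpa using (norm_nonneg _).trans (hC 0)
  refine Summable.of_norm_bounded
    ((summable_two_rpow_neg_abs_int.mul_left ((2 : ℝ) ^ |x|)).mul_left C) fun m => ?_
  exact (hC _).trans (mul_le_mul_of_nonneg_left (two_rpow_neg_abs_add_le le_rfl _) hC0)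

/-- Over a period, a periodization has the same integral as the function over the line. -/
theorem integral_tsum_comp_add_int {E : Type*} [NormedAddCommGroup E] [NormedSpace ℝ E]
    [CompleteSpace E] {f : ℝ → E} {C : ℝ} (hf : StronglyMeasurable f)
    (hC : ∀ y, ‖f y‖ ≤ C * 2 ^ (-|y|)) :
    ∫ x in (0 : ℝ)..1, ∑' m : ℤ, f (x + m) = ∫ y, f y := by
  have hC0 : 0 ≤ C := by simpa using (norm_nonneg _).trans (hC 0)
  have h1 := (integrable_of_norm_le_decay hf.aestronglyMeasurable
    hC).hasSum_intervalIntegral_comp_add_int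
  have hs := (summable_two_rpow_neg_abs_int.mul_left ((2 : ℝ) ^ (1 : ℝ))).mul_left C
  have h2 : HasSum (fun m : ℤ => ∫ x in (0 : ℝ)..1, f (x + m))
      (∫ x in (0 : ℝ)..1, ∑' m : ℤ, f (x + m)) := by
    refine intervalIntegral.hasSum_integral_of_dominated_convergence
      (fun m _ => C * (2 ^ (1 : ℝ) * 2 ^ (-|(m : ℝ)|))) (fun m => ?_) (fun m => ?_) ?_ ?_ ?_
    · exact (hf.comp_measurable (measurable_add_const _)).aestronglyMeasurable
    · refine ae_of_all _ fun x hx => (hC _).trans (mul_le_mul_of_nonneg_left ?_ hC0)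
      rw [Set.uIoc_of_le zero_le_one] at hx
      exact two_rpow_neg_abs_add_le (abs_le.mpr ⟨by linarith [hx.1], hx.2⟩) _
    · exact ae_of_all _ fun x _ => hs
    · exact intervalIntegrable_const
    · exact ae_of_all _ fun x _ => (summable_comp_add_int hC x).hasSum
  exact h2.unique h1

/-! ### The kernel `log 2 · 2 ^ y · exp (- 2 ^ y)` -/

/-- The derivative of `y ↦ - exp (- 2 ^ y)`. Up to the constant `-1`, the derivative of `g` is the
periodization of this function. -/
noncomputable def kernel (y : ℝ) : ℝ := Real.log 2 * 2 ^ y * Real.exp (-(2 : ℝ) ^ y)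

theorem continuous_two_rpow : Continuous fun y : ℝ => (2 : ℝ) ^ y :=
  Real.continuous_const_rpow two_ne_zero

theorem continuous_kernel : Continuous kernel :=
  (continuous_const.mul continuous_two_rpow).mul (Real.continuous_exp.comp continuous_two_rpow.neg)

theorem hasDerivAt_two_rpow (y : ℝ) :
    HasDerivAt (fun y : ℝ => (2 : ℝ) ^ y) (Real.log 2 * 2 ^ y) y := by
  simpa using (hasDerivAt_id y).const_rpow two_pos

theorem hasDerivAt_exp_neg_two_rpow (y : ℝ) :
    HasDerivAt (fun y : ℝ => Real.exp (-(2 : ℝ) ^ y)) (-kernel y) y := by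
  refine (hasDerivAt_two_rpow y).neg.exp.congr_deriv ?_
  simp only [kernel, Pi.neg_apply]
  ring

theorem kernel_nonneg (y : ℝ) : 0 ≤ kernel y := by
  have := Real.log_pos one_lt_two
  unfold kernel; positivity

theorem kernel_le_rpow (y : ℝ) : kernel y ≤ 2 * 2 ^ y := by
  have h : (0 : ℝ) < 2 ^ y := Real.rpow_pos_of_pos two_pos y
  have h1 : Real.exp (-(2 : ℝ) ^ y) ≤ 1 := Real.exp_le_one_iff.mpr (by linarith)
  have h2 : Real.log 2 ≤ 2 := by linarith [Real.log_two_lt_d9]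
  calc kernel y ≤ 2 * 2 ^ y * 1 := by unfold kernel; gcongr
    _ = 2 * 2 ^ y := mul_one _

theorem kernel_le_rpow_neg (y : ℝ) : kernel y ≤ 2 * 2 ^ (-y) := by
  set t : ℝ := 2 ^ y with ht
  have h : 0 < t := Real.rpow_pos_of_pos two_pos y
  have h1 : t ^ 2 / 2 ≤ Real.exp t := by linarith [Real.quadratic_le_exp_of_nonneg h.le]
  have h2 : Real.log 2 ≤ 1 := by linarith [Real.log_two_lt_d9]
  rw [kernel, Real.rpow_neg two_pos.le, Real.exp_neg, ← ht]
  rw [← div_eq_mul_inv, ← div_eq_mul_inv, div_le_div_iff₀ (Real.exp_pos _) h]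
  nlinarith [Real.exp_pos t]

theorem le_mul_two_rpow_neg_abs {a C y : ℝ} (h1 : a ≤ C * 2 ^ y) (h2 : a ≤ C * 2 ^ (-y)) :
    a ≤ C * 2 ^ (-|y|) := by
  rcases abs_cases y with ⟨h, _⟩ | ⟨h, _⟩ <;> rw [h]
  · exact h2
  · rwa [neg_neg]

theorem norm_kernel_le (y : ℝ) : ‖kernel y‖ ≤ 2 * 2 ^ (-|y|) := by
  rw [Real.norm_of_nonneg (kernel_nonneg y)]
  exact le_mul_two_rpow_neg_abs (kernel_le_rpow y) (kernel_le_rpow_neg y)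

theorem image_two_rpow : (fun y : ℝ => (2 : ℝ) ^ y) '' Set.univ = Set.Ioi 0 := by
  ext t
  simp only [Set.image_univ, Set.mem_range, Set.mem_Ioi]
  exact ⟨fun ⟨y, hy⟩ => hy ▸ Real.rpow_pos_of_pos two_pos y,
    fun ht => ⟨Real.logb 2 t, Real.rpow_logb two_pos (by norm_num) ht⟩⟩

/-- The substitution `t = 2 ^ y`. -/
theorem integral_kernel_smul {E : Type*} [NormedAddCommGroup E] [NormedSpace ℝ E] (h : ℝ → E) :
    ∫ y, kernel y • h (2 ^ y) = ∫ t in Set.Ioi (0 : ℝ), Real.exp (-t) • h t := by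
  rw [← image_two_rpow, integral_image_eq_integral_abs_deriv_smul MeasurableSet.univ
    (fun y _ => (hasDerivAt_two_rpow y).hasDerivWithinAt)
    (fun a _ b _ hab => (Real.rpow_right_inj two_pos (by norm_num)).mp hab), Measure.restrict_univ]
  refine integral_congr_ae (ae_of_all _ fun y => ?_)
  have : 0 < Real.log 2 * 2 ^ y := mul_pos (Real.log_pos one_lt_two)
    (Real.rpow_pos_of_pos two_pos y)
  simp only [smul_smul, abs_of_pos this]
  rfl

/-! ### The derivative of `g` -/

/-- The periodization of `kernel`. -/
noncomputable def kernelSum (x : ℝ) : ℝ := ∑' m : ℤ, kernel (x + m)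

theorem hasDerivAt_leftSeries (x : ℝ) :
    HasDerivAt (fun x : ℝ => ∑' j : ℕ, Real.exp (-(2 : ℝ) ^ ((j : ℝ) + x)))
      (∑' j : ℕ, -kernel (x + j)) x := by
  have hs : Summable fun j : ℕ => (2 : ℝ) * (2 ^ (|x| + 1) * (1 / 2) ^ j) :=
    (summable_geometric_two.mul_left _).mul_left _
  refine hasDerivAt_tsum_of_isPreconnected (t := Metric.ball x 1) (y₀ := x)
    (g := fun (j : ℕ) (x : ℝ) => Real.exp (-(2 : ℝ) ^ ((j : ℝ) + x)))
    (g' := fun (j : ℕ) (y : ℝ) => -kernel (y + j)) hs Metric.isOpen_ball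
    (convex_ball x 1).isPreconnected (fun j y _ => ?_) (fun j y hy => ?_)
    (Metric.mem_ball_self one_pos) (summable_left x) (Metric.mem_ball_self one_pos)
  · simpa only [add_comm (j : ℝ)] using
      (hasDerivAt_exp_neg_two_rpow (y + j)).comp_add_const y (j : ℝ)
  · rw [norm_neg, Real.norm_of_nonneg (kernel_nonneg _)]
    refine (kernel_le_rpow_neg _).trans (mul_le_mul_of_nonneg_left ?_ two_pos.le)
    rw [one_div, inv_pow, ← Real.rpow_natCast, ← Real.rpow_neg two_pos.le, ← Real.rpow_add two_pos]
    refine Real.rpow_le_rpow_of_exponent_le one_le_two ?_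
    rw [Metric.mem_ball, Real.dist_eq] at hy
    linarith [(abs_lt.mp hy).1, neg_abs_le x]

theorem hasDerivAt_rightSeries (x : ℝ) :
    HasDerivAt (fun x : ℝ => ∑' j : ℕ, (1 - Real.exp (-(2 : ℝ) ^ (-((j : ℝ) + 1) + x))))
      (∑' j : ℕ, kernel (x + -((j : ℝ) + 1))) x := by
  have hs : Summable fun j : ℕ => (2 : ℝ) * (2 ^ (|x| + 1) * (1 / 2) ^ j) :=
    (summable_geometric_two.mul_left _).mul_left _
  refine hasDerivAt_tsum_of_isPreconnected (t := Metric.ball x 1) (y₀ := x)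
    (g := fun (j : ℕ) (x : ℝ) => 1 - Real.exp (-(2 : ℝ) ^ (-((j : ℝ) + 1) + x)))
    (g' := fun (j : ℕ) (y : ℝ) => kernel (y + -((j : ℝ) + 1))) hs Metric.isOpen_ball
    (convex_ball x 1).isPreconnected (fun j y _ => ?_) (fun j y hy => ?_)
    (Metric.mem_ball_self one_pos) (summable_right x) (Metric.mem_ball_self one_pos)
  · have := ((hasDerivAt_exp_neg_two_rpow (y + -((j : ℝ) + 1))).comp_add_const y _).const_sub 1
    simpa only [add_comm (-((j : ℝ) + 1)), neg_neg] using this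
  · rw [Real.norm_of_nonneg (kernel_nonneg _)]
    refine (kernel_le_rpow _).trans (mul_le_mul_of_nonneg_left ?_ two_pos.le)
    rw [one_div, inv_pow, ← Real.rpow_natCast, ← Real.rpow_neg two_pos.le, ← Real.rpow_add two_pos]
    refine Real.rpow_le_rpow_of_exponent_le one_le_two ?_
    rw [Metric.mem_ball, Real.dist_eq] at hy
    linarith [(abs_lt.mp hy).2, le_abs_self x]

theorem hasDerivAt_g (x : ℝ) : HasDerivAt g (kernelSum x - 1) x := by
  have hs := summable_comp_add_int norm_kernel_le x
  have hsum : kernelSum x =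
      ∑' j : ℕ, kernel (x + j) + ∑' j : ℕ, kernel (x + -((j : ℝ) + 1)) := by
    have h1 : Summable fun j : ℕ => kernel (x + ((j : ℤ) : ℝ)) :=
      hs.comp_injective Nat.cast_injective
    have h2 : Summable fun j : ℕ => kernel (x + ((-((j : ℤ) + 1) : ℤ) : ℝ)) :=
      hs.comp_injective (i := fun j : ℕ => -((j : ℤ) + 1)) fun a b hab => by
        simpa using hab
    rw [kernelSum, tsum_of_nat_of_neg_add_one (f := fun m : ℤ => kernel (x + m)) h1 h2]
    simp only [Int.cast_neg, Int.cast_add, Int.cast_one, Int.cast_natCast]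
  have hlin : HasDerivAt (fun x : ℝ => -x - Real.eulerMascheroniConstant / Real.log 2 + 1 / 2)
      (-1) x := ((hasDerivAt_neg x).sub_const _).add_const _
  have h := (hlin.sub (hasDerivAt_leftSeries x)).add (hasDerivAt_rightSeries x)
  rw [tsum_neg] at h
  rw [hsum, show ∀ a b : ℝ, a + b - 1 = -1 - -a + b by intros; ring]
  exact h

theorem continuous_g : Continuous g :=
  continuous_iff_continuousAt.mpr fun x => (hasDerivAt_g x).continuousAt

/-! ### The mean of `g` -/

/-- The two series in `g`, for `x ∈ (0, 1]`, make up the periodization of this function: it equals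
`1 - exp (- 2 ^ y)` minus the unit step at `0`, which makes it decay at both ends. -/
noncomputable def stepKernel (y : ℝ) : ℝ :=
  if 0 < y then -Real.exp (-(2 : ℝ) ^ y) else 1 - Real.exp (-(2 : ℝ) ^ y)

theorem stepKernel_of_pos {y : ℝ} (hy : 0 < y) : stepKernel y = -Real.exp (-(2 : ℝ) ^ y) :=
  if_pos hy

theorem stepKernel_of_nonpos {y : ℝ} (hy : y ≤ 0) :
    stepKernel y = 1 - Real.exp (-(2 : ℝ) ^ y) :=
  if_neg hy.not_gt

theorem stronglyMeasurable_stepKernel : StronglyMeasurable stepKernel := by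
  have h : Measurable fun y : ℝ => Real.exp (-(2 : ℝ) ^ y) :=
    (Real.continuous_exp.comp continuous_two_rpow.neg).measurable
  exact (Measurable.ite measurableSet_Ioi h.neg (h.const_sub 1)).stronglyMeasurable

theorem norm_stepKernel_le (y : ℝ) : ‖stepKernel y‖ ≤ 1 * 2 ^ (-|y|) := by
  have h := Real.rpow_pos_of_pos two_pos y
  rcases lt_or_ge 0 y with hy | hy
  · rw [stepKernel_of_pos hy, norm_neg, Real.norm_of_nonneg (Real.exp_pos _).le, abs_of_pos hy,
      Real.rpow_neg two_pos.le, Real.exp_neg, one_mul]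
    exact inv_anti₀ h (by linarith [Real.add_one_le_exp ((2 : ℝ) ^ y)])
  · have h1 : Real.exp (-(2 : ℝ) ^ y) ≤ 1 := Real.exp_le_one_iff.mpr (by linarith)
    rw [stepKernel_of_nonpos hy, Real.norm_of_nonneg (by linarith), abs_of_nonpos hy, neg_neg]
    linarith [Real.add_one_le_exp (-(2 : ℝ) ^ y)]

theorem norm_mul_self_le {f : ℝ → ℝ} {C : ℝ} (hC : ∀ y, ‖f y‖ ≤ C * 2 ^ (-|y|)) (y : ℝ) :
    ‖y * f y‖ ≤ C * (3 * 2 ^ (-|1 / 2 * y|)) := by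
  have hC0 : 0 ≤ C := by simpa using (norm_nonneg _).trans (hC 0)
  rw [norm_mul, Real.norm_eq_abs y]
  calc |y| * ‖f y‖ ≤ |y| * (C * 2 ^ (-|y|)) := by gcongr; exact hC y
    _ = C * (|y| * 2 ^ (-|y|)) := by ring
    _ ≤ C * (3 * 2 ^ (-|1 / 2 * y|)) :=
      mul_le_mul_of_nonneg_left (abs_mul_two_rpow_neg_abs_le y) hC0

theorem integrable_mul_kernel : Integrable fun y => y * kernel y :=
  ((integrable_two_rpow_neg_abs_half.const_mul 3).const_mul 2).mono'
    (continuous_id.mul continuous_kernel).aestronglyMeasurable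
    (ae_of_all _ (norm_mul_self_le norm_kernel_le))

theorem integrable_stepKernel : Integrable stepKernel :=
  integrable_of_norm_le_decay stronglyMeasurable_stepKernel.aestronglyMeasurable norm_stepKernel_le

theorem tendsto_two_rpow_neg_abs_half {l : Filter ℝ} (hl : Tendsto (fun y : ℝ => |y|) l atTop) :
    Tendsto (fun y : ℝ => 1 * (3 * (2 : ℝ) ^ (-|1 / 2 * y|))) l (𝓝 0) := by
  have h : Tendsto (fun y : ℝ => |1 / 2 * y|) l atTop := by
    simp only [abs_mul]
    exact hl.const_mul_atTop (by norm_num)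
  have h2 := (tendsto_rpow_atTop_of_base_gt_one 2 one_lt_two).comp h |>.inv_tendsto_atTop
  simpa [Real.rpow_neg two_pos.le] using h2.const_mul 3

/-- Integration by parts; the jump of `stepKernel` at `0` is killed by the factor `y`. -/
theorem integral_stepKernel_eq : ∫ y, stepKernel y = -∫ y, y * kernel y := by
  have hint : Integrable fun y => stepKernel y + y * kernel y :=
    integrable_stepKernel.add integrable_mul_kernel
  have hpos : ∫ y in Set.Ioi 0, (stepKernel y + y * kernel y) = 0 := by
    have hcongr : ∀ y ∈ Set.Ioi (0 : ℝ), stepKernel y + y * kernel y =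
        1 * -Real.exp (-(2 : ℝ) ^ y) + y * - -kernel y := fun y hy => by
      rw [stepKernel_of_pos hy]; ring
    rw [setIntegral_congr_fun measurableSet_Ioi hcongr,
      integral_Ioi_of_hasDerivAt_of_tendsto' (f := fun y => y * -Real.exp (-(2 : ℝ) ^ y)) (m := 0)
        (fun y _ => (hasDerivAt_id' y).mul (hasDerivAt_exp_neg_two_rpow y).neg)
        (hint.integrableOn.congr_fun hcongr measurableSet_Ioi)]
    · simp
    · refine squeeze_zero_norm' ?_ (tendsto_two_rpow_neg_abs_half tendsto_abs_atTop_atTop)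
      filter_upwards [eventually_gt_atTop 0] with y hy
      rw [← stepKernel_of_pos hy]
      exact norm_mul_self_le norm_stepKernel_le y
  have hneg : ∫ y in Set.Iic 0, (stepKernel y + y * kernel y) = 0 := by
    have hcongr : ∀ y ∈ Set.Iic (0 : ℝ), stepKernel y + y * kernel y =
        1 * (1 - Real.exp (-(2 : ℝ) ^ y)) + y * - -kernel y := fun y hy => by
      rw [stepKernel_of_nonpos hy]; ring
    rw [setIntegral_congr_fun measurableSet_Iic hcongr,
      integral_Iic_of_hasDerivAt_of_tendsto' (f := fun y => y * (1 - Real.exp (-(2 : ℝ) ^ y)))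
        (m := 0)
        (fun y _ => (hasDerivAt_id' y).mul ((hasDerivAt_exp_neg_two_rpow y).const_sub 1))
        (hint.integrableOn.congr_fun hcongr measurableSet_Iic)]
    · simp
    · refine squeeze_zero_norm' ?_ (tendsto_two_rpow_neg_abs_half tendsto_abs_atBot_atTop)
      filter_upwards [eventually_le_atBot 0] with y hy
      rw [← stepKernel_of_nonpos hy]
      exact norm_mul_self_le norm_stepKernel_le y
  have htot : ∫ y, (stepKernel y + y * kernel y) = 0 := by
    rw [← intervalIntegral.integral_Iic_add_Ioi hint.integrableOn hint.integrableOn]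
    exact (congrArg₂ (· + ·) hneg hpos).trans (add_zero 0)
  rw [integral_add integrable_stepKernel integrable_mul_kernel] at htot
  linarith

/-- The integral is `Γ'(1)`. -/
theorem integral_exp_neg_mul_log :
    ∫ t in Set.Ioi (0 : ℝ), Real.exp (-t) * Real.log t = -Real.eulerMascheroniConstant := by
  have h1 := Complex.hasDerivAt_GammaIntegral (s := 1) (by simp)
  have h2 : HasDerivAt Complex.GammaIntegral (-(Real.eulerMascheroniConstant : ℂ)) 1 := by
    refine Complex.hasDerivAt_Gamma_one.congr_of_eventuallyEq ?_
    have : {s : ℂ | 0 < s.re} ∈ 𝓝 (1 : ℂ) :=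
      (isOpen_lt continuous_const Complex.continuous_re).mem_nhds (by simp)
    filter_upwards [this] with s hs
    exact (Complex.Gamma_eq_integral hs).symm
  have h3 := h1.unique h2
  apply Complex.ofReal_injective
  rw [← integral_complex_ofReal, Complex.ofReal_neg, ← h3]
  refine setIntegral_congr_fun measurableSet_Ioi fun t _ => ?_
  simp [mul_comm]

theorem integral_stepKernel :
    ∫ y, stepKernel y = Real.eulerMascheroniConstant / Real.log 2 := by
  have hlog : Real.log 2 ≠ 0 := (Real.log_pos one_lt_two).ne'
  have h := integral_kernel_smul Real.log
  simp only [smul_eq_mul, integral_exp_neg_mul_log, Real.log_rpow two_pos] at h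
  have e : ∀ y, kernel y * (y * Real.log 2) = Real.log 2 * (y * kernel y) := fun y => by ring
  simp only [e, integral_const_mul] at h
  rw [integral_stepKernel_eq, eq_div_iff hlog]
  linarith

theorem g_eq_tsum_stepKernel {x : ℝ} (hx : x ∈ Set.Ioc (0 : ℝ) 1) :
    g x = -x - Real.eulerMascheroniConstant / Real.log 2 + 1 / 2 +
      ∑' m : ℤ, stepKernel (x + m) := by
  have h1 : ∀ j : ℕ, stepKernel (x + ((j : ℤ) : ℝ)) = -Real.exp (-(2 : ℝ) ^ ((j : ℝ) + x)) :=
    fun j => by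
      have hj : (0 : ℝ) ≤ j := j.cast_nonneg
      rw [Int.cast_natCast, stepKernel_of_pos (by linarith [hx.1]), add_comm]
  have h2 : ∀ j : ℕ, stepKernel (x + ((-((j : ℤ) + 1) : ℤ) : ℝ)) =
      1 - Real.exp (-(2 : ℝ) ^ (-((j : ℝ) + 1) + x)) := fun j => by
    have hj : (0 : ℝ) ≤ j := j.cast_nonneg
    rw [Int.cast_neg, Int.cast_add, Int.cast_one, Int.cast_natCast,
      stepKernel_of_nonpos (by linarith [hx.2]), add_comm x]
  rw [tsum_of_nat_of_neg_add_one (f := fun m : ℤ => stepKernel (x + m))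
    ((summable_left x).neg.congr fun j => (h1 j).symm)
    ((summable_right x).congr fun j => (h2 j).symm), tsum_congr h1, tsum_congr h2, tsum_neg, g]
  ring

theorem integral_g : ∫ x in (0 : ℝ)..1, g x = 0 := by
  have h1 : ∫ x in (0 : ℝ)..1, (-x - Real.eulerMascheroniConstant / Real.log 2 + 1 / 2) =
      -(Real.eulerMascheroniConstant / Real.log 2) := by
    have hc : ∀ {f : ℝ → ℝ}, Continuous f → IntervalIntegrable f volume 0 1 :=
      fun hf => hf.intervalIntegrable _ _
    rw [intervalIntegral.integral_add (hc (by fun_prop)) (hc (by fun_prop)),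
      intervalIntegral.integral_sub (hc (by fun_prop)) (hc (by fun_prop)),
      intervalIntegral.integral_neg, integral_id]
    simp
    ring
  have h2 : ∫ x in (0 : ℝ)..1, (g x -
      (-x - Real.eulerMascheroniConstant / Real.log 2 + 1 / 2)) =
      Real.eulerMascheroniConstant / Real.log 2 := by
    refine Eq.trans ?_ ((integral_tsum_comp_add_int stronglyMeasurable_stepKernel
      norm_stepKernel_le).trans integral_stepKernel)
    refine intervalIntegral.integral_congr_ae (ae_of_all _ fun x hx => ?_)
    rw [Set.uIoc_of_le zero_le_one] at hx
    simp only [g_eq_tsum_stepKernel hx, add_sub_cancel_left]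
  rw [intervalIntegral.integral_sub (continuous_g.intervalIntegrable _ _)
    (Continuous.intervalIntegrable (by fun_prop) _ _), h1] at h2
  linarith

/-! ### The Fourier coefficients of `g` -/

/-- The angular frequency `2 π n / log 2`, in the variable `log t = y log 2`, of the `n`-th
harmonic in `y`. -/
noncomputable def freq (n : ℤ) : ℝ := 2 * Real.pi * n / Real.log 2

theorem one_sub_mul_I_re (t : ℝ) : (1 - (t : ℂ) * Complex.I).re = 1 := by simp

/-- The substitution `t = 2 ^ y` turns the Fourier integral of `kernel` into Euler's integral. -/
theorem fourierIntegral_kernel (n : ℤ) :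
    ∫ y : ℝ, Complex.exp (-(2 * Real.pi * Complex.I * n * y)) * (kernel y : ℂ) =
      Complex.Gamma (1 - freq n * Complex.I) := by
  have hlog : (Real.log 2 : ℂ) ≠ 0 := by exact_mod_cast (Real.log_pos one_lt_two).ne'
  rw [Complex.Gamma_eq_integral (by rw [one_sub_mul_I_re]; exact one_pos), Complex.GammaIntegral]
  have h := integral_kernel_smul fun t : ℝ => (t : ℂ) ^ (-(freq n * Complex.I))
  simp only [Complex.real_smul] at h
  rw [show (1 - freq n * Complex.I - 1 : ℂ) = -(freq n * Complex.I) by ring, ← h]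
  refine integral_congr_ae (ae_of_all _ fun y => ?_)
  have h2 : (2 : ℝ) ^ y ≠ 0 := (Real.rpow_pos_of_pos two_pos y).ne'
  simp only
  rw [mul_comm, Complex.cpow_def_of_ne_zero (by exact_mod_cast h2),
    ← Complex.ofReal_log (Real.rpow_pos_of_pos two_pos y).le, Real.log_rpow two_pos]
  congr 2
  rw [freq]
  push_cast
  field_simp

theorem norm_exp_neg_two_pi_I_mul (n : ℤ) (y : ℝ) :
    ‖Complex.exp (-(2 * Real.pi * Complex.I * n * y))‖ = 1 := by
  have : (-(2 * Real.pi * Complex.I * n * y) : ℂ) = ((-(2 * Real.pi * n * y) : ℝ) : ℂ) *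
    Complex.I := by push_cast; ring
  rw [this, Complex.norm_exp_ofReal_mul_I]

theorem continuous_exp_neg_two_pi_I_mul (n : ℤ) :
    Continuous fun y : ℝ => Complex.exp (-(2 * Real.pi * Complex.I * n * y)) := by
  fun_prop

theorem integral_exp_mul_kernelSum (n : ℤ) :
    ∫ x in (0 : ℝ)..1, Complex.exp (-(2 * Real.pi * Complex.I * n * x)) * (kernelSum x : ℂ) =
      Complex.Gamma (1 - freq n * Complex.I) := by
  set f : ℝ → ℂ := fun y => Complex.exp (-(2 * Real.pi * Complex.I * n * y)) * (kernel y : ℂ)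
    with hf
  have hcont : Continuous f := (continuous_exp_neg_two_pi_I_mul n).mul
    (Complex.continuous_ofReal.comp continuous_kernel)
  have hnorm : ∀ y, ‖f y‖ ≤ 2 * 2 ^ (-|y|) := fun y => by
    rw [hf]
    simp only
    rw [norm_mul, norm_exp_neg_two_pi_I_mul, one_mul, Complex.norm_real]
    exact norm_kernel_le y
  rw [← fourierIntegral_kernel, ← integral_tsum_comp_add_int hcont.stronglyMeasurable hnorm]
  refine intervalIntegral.integral_congr fun x _ => ?_
  simp only [kernelSum, Complex.ofReal_tsum, hf]
  rw [← tsum_mul_left]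
  refine tsum_congr fun m => ?_
  congr 1
  -- The exponential has period `1` in `x`.
  rw [Complex.exp_eq_exp_iff_exists_int]
  refine ⟨n * m, ?_⟩
  push_cast
  ring

theorem intervalIntegrable_kernelSum :
    IntervalIntegrable (fun x => (kernelSum x : ℂ)) volume 0 1 := by
  suffices h : IntervalIntegrable kernelSum volume 0 1 from ⟨h.1.ofReal, h.2.ofReal⟩
  refine intervalIntegral.intervalIntegrable_deriv_of_nonneg (g := fun x => g x + x)
    (continuous_g.add continuous_id).continuousOn (fun x _ => ?_)
    (fun x _ => tsum_nonneg fun m => kernel_nonneg _)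
  exact ((hasDerivAt_g x).add (hasDerivAt_id' x)).congr_deriv (by ring)

theorem fourierCoeffOn_zero_one (f : ℝ → ℂ) (n : ℤ) :
    fourierCoeffOn (zero_lt_one (α := ℝ)) f n =
      ∫ x in (0 : ℝ)..1, Complex.exp (-(2 * Real.pi * Complex.I * n * x)) * f x := by
  rw [fourierCoeffOn_eq_integral]
  simp only [fourier_coe_apply, sub_zero, div_one, one_smul, smul_eq_mul, Int.cast_neg,
    Complex.ofReal_one, div_one, mul_neg, neg_mul]

theorem integral_exp_neg_two_pi_I_mul {n : ℤ} (hn : n ≠ 0) :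
    ∫ x in (0 : ℝ)..1, Complex.exp (-(2 * Real.pi * Complex.I * n * x)) = 0 := by
  have h := fourierCoeffOn_of_hasDerivAt zero_lt_one hn (fun x _ => hasDerivAt_const x (1 : ℂ))
    intervalIntegrable_const
  simpa [fourierCoeffOn_zero_one] using h

theorem fourierCoeffOn_deriv_g {n : ℤ} (hn : n ≠ 0) :
    fourierCoeffOn (zero_lt_one (α := ℝ)) (fun x => ((kernelSum x - 1 : ℝ) : ℂ)) n =
      Complex.Gamma (1 - freq n * Complex.I) := by
  rw [fourierCoeffOn_zero_one, ← integral_exp_mul_kernelSum]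
  simp only [Complex.ofReal_sub, Complex.ofReal_one, mul_sub, mul_one]
  rw [intervalIntegral.integral_sub, integral_exp_neg_two_pi_I_mul hn, sub_zero]
  · exact intervalIntegrable_kernelSum.continuousOn_mul
      (continuous_exp_neg_two_pi_I_mul n).continuousOn
  · exact (continuous_exp_neg_two_pi_I_mul n).intervalIntegrable _ _

theorem fourierCoeffOn_g {n : ℤ} (hn : n ≠ 0) :
    fourierCoeffOn (zero_lt_one (α := ℝ)) (fun x => (g x : ℂ)) n =
      Complex.Gamma (1 - freq n * Complex.I) / (2 * Real.pi * Complex.I * n) := by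
  rw [fourierCoeffOn_of_hasDerivAt zero_lt_one hn (fun x _ => (hasDerivAt_g x).ofReal_comp)
    (by simpa only [Complex.ofReal_sub] using
      intervalIntegrable_kernelSum.sub intervalIntegrable_const), fourierCoeffOn_deriv_g hn]
  have h : g 1 = g 0 := by simpa using periodic_g 0
  rw [h]
  push_cast
  field_simp
  ring

/-- `g` as a continuous function on the circle `ℝ / ℤ`. -/
noncomputable def gCircle : C(AddCircle (1 : ℝ), ℂ) where
  toFun := Function.Periodic.lift (f := fun x : ℝ => (g x : ℂ)) (c := 1) fun x => by
    simp only [periodic_g x]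
  continuous_toFun :=
    continuous_coinduced_dom.mpr (Complex.continuous_ofReal.comp continuous_g)

theorem gCircle_coe (x : ℝ) : gCircle (x : AddCircle (1 : ℝ)) = g x := rfl

theorem fourierCoeff_gCircle (n : ℤ) :
    fourierCoeff gCircle n = fourierCoeffOn (zero_lt_one (α := ℝ)) (fun x => (g x : ℂ)) n := by
  rw [fourierCoeff_eq_intervalIntegral _ _ 0, fourierCoeffOn_zero_one]
  simp only [fourier_coe_apply, gCircle_coe, zero_add, one_smul, smul_eq_mul,
    Int.cast_neg, Complex.ofReal_one, div_one, mul_neg, neg_mul]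

theorem fourierCoeff_gCircle_zero : fourierCoeff gCircle 0 = 0 := by
  rw [fourierCoeff_gCircle, fourierCoeffOn_zero_one]
  simp [intervalIntegral.integral_ofReal, integral_g]

/-- A constant `g` would have `kernelSum = 1`, but the first Fourier coefficient of `kernelSum` is a
value of the Gamma function, which has no zeros. -/
theorem not_exists_g_eq_const : ¬ ∃ a : ℝ, ∀ x : ℝ, g x = a := by
  rintro ⟨a, ha⟩
  have hk : ∀ x, kernelSum x = 1 := fun x => by
    have h := hasDerivAt_g x
    rw [show g = fun _ => a from funext ha] at h
    linarith [h.unique (hasDerivAt_const x a)]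
  have h := integral_exp_mul_kernelSum 1
  simp only [hk, Complex.ofReal_one, mul_one] at h
  rw [integral_exp_neg_two_pi_I_mul one_ne_zero] at h
  exact Complex.Gamma_ne_zero_of_re_pos (by rw [one_sub_mul_I_re]; exact one_pos) h.symm

/-! ### The amplitude of `g` -/

/-- The reflection formula on the line `re s = 1`. -/
theorem norm_Gamma_one_sub_mul_I_sq {t : ℝ} (ht : t ≠ 0) :
    ‖Complex.Gamma (1 - t * Complex.I)‖ ^ 2 = Real.pi * t / Real.sinh (Real.pi * t) := by
  have htI : (t : ℂ) * Complex.I ≠ 0 := mul_ne_zero (by exact_mod_cast ht) Complex.I_ne_zero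
  have hconj : (starRingEnd ℂ) (Complex.Gamma (1 - t * Complex.I)) =
      Complex.Gamma (t * Complex.I + 1) := by
    rw [← Complex.Gamma_conj]
    congr 1
    simp only [map_sub, map_one, map_mul, Complex.conj_ofReal, Complex.conj_I]
    ring
  have h := Complex.Gamma_mul_Gamma_one_sub (t * Complex.I)
  apply Complex.ofReal_injective
  rw [← Complex.normSq_eq_norm_sq, ← Complex.mul_conj, hconj, Complex.Gamma_add_one _ htI,
    mul_left_comm, mul_comm (Complex.Gamma _) (Complex.Gamma (t * Complex.I)), h, ← mul_assoc,
    Complex.sin_mul_I]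
  push_cast
  rw [← mul_div_assoc, mul_right_comm, mul_div_mul_right _ _ Complex.I_ne_zero, mul_comm (t : ℂ)]

theorem norm_fourierCoeff_gCircle_sq {n : ℤ} (hn : n ≠ 0) :
    ‖fourierCoeff gCircle n‖ ^ 2 =
      1 / (2 * Real.log 2 * n * Real.sinh (n * (2 * Real.pi ^ 2 / Real.log 2))) := by
  have hn' : (n : ℝ) ≠ 0 := by exact_mod_cast hn
  have hlog : Real.log 2 ≠ 0 := (Real.log_pos one_lt_two).ne'
  have hpi := Real.pi_pos.ne'
  have hf : freq n ≠ 0 := by unfold freq; positivity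
  rw [fourierCoeff_gCircle, fourierCoeffOn_g hn, norm_div, div_pow,
    norm_Gamma_one_sub_mul_I_sq hf]
  simp only [norm_mul, Complex.norm_real, Complex.norm_I, Complex.norm_ofNat,
    Complex.norm_intCast, mul_one, mul_pow, Real.norm_eq_abs, sq_abs]
  rw [show Real.pi * freq n = n * (2 * Real.pi ^ 2 / Real.log 2) by rw [freq]; ring, div_div,
    div_eq_div_iff]
  · field_simp
  · have : Real.sinh (n * (2 * Real.pi ^ 2 / Real.log 2)) ≠ 0 := by
      rw [Ne, Real.sinh_eq_zero]; positivity
    positivity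
  · have : Real.sinh (n * (2 * Real.pi ^ 2 / Real.log 2)) ≠ 0 := by
      rw [Ne, Real.sinh_eq_zero]; positivity
    positivity

/-- The true value is about `2.33 * 10 ^ 12`. -/
theorem le_exp_two_pi_sq_div_log_two :
    (2.27e12 : ℝ) ≤ Real.exp (2 * Real.pi ^ 2 / Real.log 2) := by
  have hlog := Real.log_two_lt_d9
  have hpi := Real.pi_gt_d6
  have h1 : (28.46 : ℝ) ≤ 2 * Real.pi ^ 2 / Real.log 2 := by
    rw [le_div_iff₀ (Real.log_pos one_lt_two)]
    nlinarith
  have h2 : (1.44e12 : ℝ) ≤ Real.exp 28 := by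
    rw [show (28 : ℝ) = (28 : ℕ) * 1 by norm_num, Real.exp_nat_mul]
    refine le_trans ?_ (pow_le_pow_left₀ (by norm_num) Real.exp_one_gt_d9.le 28)
    norm_num
  -- Halving `0.46` makes the quadratic Taylor bound sharp enough.
  have h3 : (1.25645 : ℝ) ≤ Real.exp 0.23 :=
    le_trans (by norm_num) (Real.quadratic_le_exp_of_nonneg (by norm_num : (0 : ℝ) ≤ 0.23))
  refine le_trans ?_ (Real.exp_le_exp.mpr h1)
  rw [show (28.46 : ℝ) = 28 + (0.23 + 0.23) by norm_num, Real.exp_add, Real.exp_add]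
  calc (2.27e12 : ℝ) ≤ 1.44e12 * (1.25645 * 1.25645) := by norm_num
    _ ≤ _ := by gcongr

theorem le_sinh_mul (k : ℕ) : (1.1349e12 : ℝ) * (10 ^ 6) ^ k ≤
    Real.sinh ((k + 1 : ℕ) * (2 * Real.pi ^ 2 / Real.log 2)) := by
  have hE := le_exp_two_pi_sq_div_log_two
  set A := 2 * Real.pi ^ 2 / Real.log 2
  have hA : 0 < A := by
    by_contra h
    linarith [Real.exp_le_one_iff.mpr (not_lt.mp h)]
  have hneg : Real.exp (-A) ≤ 1 := Real.exp_le_one_iff.mpr (by linarith)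
  induction k with
  | zero =>
    rw [pow_zero, zero_add, Nat.cast_one, one_mul, Real.sinh_eq]
    linarith
  | succ k ih =>
    have h1 : (10 ^ 6 : ℝ) ≤ Real.cosh A := by
      rw [Real.cosh_eq]
      linarith [Real.exp_pos (-A)]
    have h2 : 0 ≤ Real.sinh A := Real.sinh_nonneg_iff.mpr hA.le
    rw [show ((k + 1 + 1 : ℕ) : ℝ) * A = (k + 1 : ℕ) * A + A by push_cast; ring, Real.sinh_add,
      pow_succ, ← mul_assoc]
    refine (mul_le_mul ih h1 (by positivity) (le_trans (by positivity) ih)).trans ?_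
    exact le_add_of_nonneg_right (mul_nonneg (Real.cosh_pos _).le h2)

/-- The constant is slightly above the norm `7.863… * 10⁻⁷` of the coefficients `± 1`. -/
theorem norm_fourierCoeff_gCircle_le {n : ℤ} {k : ℕ} (hn : n.natAbs = k + 1) :
    ‖fourierCoeff gCircle n‖ ≤ 7.98e-7 * (1 / 1000) ^ k := by
  have hn0 : n ≠ 0 := by omega
  have hsinh := le_sinh_mul k
  have hlog := Real.log_two_gt_d9
  have heven : (n : ℝ) * Real.sinh (n * (2 * Real.pi ^ 2 / Real.log 2)) =
      (k + 1 : ℕ) * Real.sinh ((k + 1 : ℕ) * (2 * Real.pi ^ 2 / Real.log 2)) := by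
    rcases Int.natAbs_eq n with h | h <;> rw [h, hn]
    · rw [Int.cast_natCast]
    · rw [Int.cast_neg, neg_mul, neg_mul (((k + 1 : ℕ) : ℤ) : ℝ),
        Real.sinh_neg, mul_neg, neg_neg, Int.cast_natCast]
  have hk : (1 : ℝ) ≤ (k + 1 : ℕ) := by exact_mod_cast Nat.le_add_left 1 k
  have hp : (0 : ℝ) < (10 ^ 6) ^ k := by positivity
  refine (sq_le_sq₀ (norm_nonneg _) (by positivity)).mp ?_
  rw [norm_fourierCoeff_gCircle_sq hn0, mul_assoc, heven, mul_pow, ← pow_mul, mul_comm k 2, pow_mul,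
    show ((1 / 1000 : ℝ) ^ 2) = (10 ^ 6)⁻¹ by norm_num, inv_pow]
  set S := Real.sinh ((k + 1 : ℕ) * (2 * Real.pi ^ 2 / Real.log 2))
  have hden : (1.573e12 : ℝ) * (10 ^ 6) ^ k ≤ 2 * Real.log 2 * ((k + 1 : ℕ) * S) := by
    have h1 : 1 * (1.1349e12 * (10 ^ 6) ^ k) ≤ ((k + 1 : ℕ) : ℝ) * S :=
      mul_le_mul hk hsinh (by positivity) (by positivity)
    have h2 : 2 * 0.6931471803 * (1 * (1.1349e12 * (10 ^ 6) ^ k)) ≤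
        2 * Real.log 2 * (((k + 1 : ℕ) : ℝ) * S) :=
      mul_le_mul (by linarith) h1 (by positivity) (by linarith)
    refine le_trans ?_ h2
    rw [one_mul, ← mul_assoc]
    exact mul_le_mul_of_nonneg_right (by norm_num) hp.le
  refine (one_div_le_one_div_of_le (by positivity) hden).trans ?_
  rw [one_div, mul_inv]
  exact mul_le_mul_of_nonneg_right (by norm_num) (by positivity)

theorem abs_g_le (x : ℝ) : |g x| ≤ 0.0000016 := by
  have hr : HasSum (fun k : ℕ => (7.98e-7 : ℝ) * (1 / 1000) ^ k) (7.98e-7 * (1 - 1 / 1000)⁻¹) :=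
    (hasSum_geometric_of_lt_one (by norm_num) (by norm_num)).mul_left _
  have hpos : ∀ k : ℕ, ‖fourierCoeff gCircle ((k + 1 : ℕ) : ℤ)‖ ≤ 7.98e-7 * (1 / 1000) ^ k :=
    fun k => norm_fourierCoeff_gCircle_le (by omega)
  have hneg : ∀ k : ℕ, ‖fourierCoeff gCircle (-((k : ℤ) + 1))‖ ≤ 7.98e-7 * (1 / 1000) ^ k :=
    fun k => norm_fourierCoeff_gCircle_le (by omega)
  have hs1 : Summable fun k : ℕ => ‖fourierCoeff gCircle ((k + 1 : ℕ) : ℤ)‖ :=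
    Summable.of_nonneg_of_le (fun _ => norm_nonneg _) hpos hr.summable
  have hs2 : Summable fun k : ℕ => ‖fourierCoeff gCircle (-((k : ℤ) + 1))‖ :=
    Summable.of_nonneg_of_le (fun _ => norm_nonneg _) hneg hr.summable
  have hs0 : Summable fun k : ℕ => ‖fourierCoeff gCircle (k : ℤ)‖ :=
    (summable_nat_add_iff (f := fun k : ℕ => ‖fourierCoeff gCircle (k : ℤ)‖) 1).mp hs1
  have hs : Summable fun n : ℤ => ‖fourierCoeff gCircle n‖ := Summable.of_nat_of_neg_add_one hs0 hs2
  have hsum := has_pointwise_sum_fourier_series_of_summable hs.of_norm (x : AddCircle (1 : ℝ))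
  have hnorm : ∀ n : ℤ, ‖fourierCoeff gCircle n • fourier n (x : AddCircle (1 : ℝ))‖ =
      ‖fourierCoeff gCircle n‖ := fun n => by
    rw [smul_eq_mul, norm_mul, fourier_apply, Circle.norm_coe, mul_one]
  rw [← Real.norm_eq_abs, ← Complex.norm_real, ← gCircle_coe, ← hsum.tsum_eq]
  refine (norm_tsum_le_tsum_norm (by simpa only [hnorm] using hs)).trans ?_
  simp only [hnorm]
  rw [tsum_of_nat_of_neg_add_one (f := fun n : ℤ => ‖fourierCoeff gCircle n‖) hs0 hs2,
    hs0.tsum_eq_zero_add, Nat.cast_zero, fourierCoeff_gCircle_zero, norm_zero, zero_add]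
  refine (add_le_add (hs1.tsum_le_tsum hpos hr.summable)
    (hs2.tsum_le_tsum hneg hr.summable)).trans ?_
  rw [hr.tsum_eq]
  norm_num

end RandomComposition

theorem mainTheorem1 :
    Continuous RandomComposition.g ∧
    Function.Periodic RandomComposition.g 1 ∧
    (∫ x in (0 : ℝ)..1, RandomComposition.g x) = 0 ∧
    (∀ x : ℝ, |RandomComposition.g x| ≤ 0.0000016) ∧
    (¬ ∃ a : ℝ, ∀ x : ℝ, RandomComposition.g x = a) ∧
    Tendsto
      (fun n : ℕ =>
        RandomComposition.expectedDistinctParts n -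
          (Real.logb 2 (n : ℝ) + Real.eulerMascheroniConstant / Real.log 2 - 3 / 2 +
            RandomComposition.g (Real.logb 2 (n : ℝ))))
      atTop (𝓝 0) :=
  ⟨RandomComposition.continuous_g, RandomComposition.periodic_g, RandomComposition.integral_g,
    RandomComposition.abs_g_le, RandomComposition.not_exists_g_eq_const,
    RandomComposition.tendsto_expectedDistinctParts⟩
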